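/- Let $m\ge 1$ and $n$ be integers, let $f_1,\dots,f_n$ and $w_1,\dots,w_n$ be real numbers (for instance $w_j=j$), and let $q_0=1$ and $q_1,\dots,q_m\in\mathbb R$. For integers $a\le b$ write $[a,b]=\{a,a+1,\dots,b\}$. Consider the discrete moment problem over log-concave distributions (DMP-LC): maximize $\sum_{j=1}^n f_jx_j$ over all $x\in\mathbb R^n$ for which there are integers $1\le k\le \ell\le n$ with $$\sum_{j=k}^{\ell} w_j^i x_j=q_i\ (0\le i\le m),\qquad x_{j-1}x_{j+1}\le x_j^2\ (k<j<\ell),\qquad x_j>0\ (j\in[k,\ell]),\qquad x_j=0\ (j\notin[k,\ell]).$$ Let $S\subseteq\mathbb R^n$ be the set of all these feasible $x$. A point $x\in S$ is called an extreme point of $S$ if there are no $d\neq 0$ in $\mathbb R^n$ and $\varepsilon>0$ such that both $x+\varepsilon d$ and $x-\varepsilon d$ lie in $S$. Theorem. If $S\neq\emptyset$, then (DMP-LC) has an optimal solution that is an extreme point of $S$. Moreover, every optimal solution $x^*$ that is an extreme point of $S$ has the following structure. Its support is $[k,\ell]$ for some $1\le k\le\ell\le n$, and there are an integer $1\le p\le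 m$, with $p=m$ whenever $\ell-k\ge m$, integers $u_i,v_i$ ($1\le i\le p$) with $$k=u_1<v_1=u_2<v_2=\dots=u_p<v_p=\ell,$$ and real numbers $\alpha_i>0$, $r_i>0$ ($1\le i\le p$) such that $x^*_j=\alpha_i r_i^{\,j-u_i}$ for all $j\in[u_i,v_i]$ and $1\le i\le p$, and $x^*_j=0$ for all other $j$. (If $k=\ell$, this is read as $p=1$ and $u_1=v_1=k$.) Thus $x^*$ is piecewise geometric with at most $m$ pieces. -/

import Mathlib

/-- `x ∈ ℝⁿ` satisfies the constraints of the discrete moment problem over log-concave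
distributions for the support `[k, ℓ]`: the moment equations of order `0, …, m` at the sample
points `w j`, the log-concavity inequalities at the indices strictly between `k` and `ℓ`,
positivity on `[k, ℓ]`, and vanishing outside. Indices run over `Fin n`, so the `j`-th coordinate
in one-based counting has index `j - 1`. -/
structure LCFeasibleOn {n m : ℕ} (w : Fin n → ℝ) (q : Fin (m + 1) → ℝ) (k ℓ : Fin n)
    (x : Fin n → ℝ) : Prop where
  moments : ∀ i : Fin (m + 1), ∑ j ∈ Finset.Icc k ℓ, w j ^ (i : ℕ) * x j = q i
  logConcave : ∀ a b c : Fin n, (a : ℕ) + 1 = b → (b : ℕ) + 1 = c → k < b → b < ℓ →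
    x a * x c ≤ x b ^ 2
  pos : ∀ j, k ≤ j → j ≤ ℓ → 0 < x j
  zero : ∀ j, ¬ (k ≤ j ∧ j ≤ ℓ) → x j = 0

/-- The feasible region of the problem: the union over all supports `[k, ℓ]`. -/
def lcFeasibleSet {n m : ℕ} (w : Fin n → ℝ) (q : Fin (m + 1) → ℝ) : Set (Fin n → ℝ) :=
  {x | ∃ k ℓ : Fin n, k ≤ ℓ ∧ LCFeasibleOn w q k ℓ x}

/-- The objective `∑ j, f j * x j`. For `x` vanishing outside `[k, ℓ]` it is the sum over
`j ∈ [k, ℓ]`. -/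
def lcObjective {n : ℕ} (f x : Fin n → ℝ) : ℝ := ∑ j, f j * x j

/-- `x` is an optimal solution (a global maximizer over all supports). -/
def IsLCOptimal {n m : ℕ} (w : Fin n → ℝ) (q : Fin (m + 1) → ℝ) (f x : Fin n → ℝ) : Prop :=
  x ∈ lcFeasibleSet w q ∧ ∀ y ∈ lcFeasibleSet w q, lcObjective f y ≤ lcObjective f x

/-- Extreme points of a (not necessarily convex) set `S ⊆ ℝⁿ`: points `x ∈ S` such that
`x + ε d` and `x - ε d` both lie in `S` for no direction `d ≠ 0` and no `ε > 0`. -/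
def IsExtremePointOf {n : ℕ} (S : Set (Fin n → ℝ)) (x : Fin n → ℝ) : Prop :=
  x ∈ S ∧ ¬ ∃ d : Fin n → ℝ, d ≠ 0 ∧ ∃ ε : ℝ, 0 < ε ∧ x + ε • d ∈ S ∧ x - ε • d ∈ S

/-- `x` is geometric on each of `p ≥ 1` pieces `[u i, v i]` with
`k = u 0 < v 0 = u 1 < v 1 = ⋯ = u (p - 1) < v (p - 1) = ℓ`, and zero elsewhere.
If `k = ℓ`, the strict inequalities are dropped (there is one piece, consisting of one point). -/
def IsPiecewiseGeometric {n : ℕ} (x : Fin n → ℝ) (k ℓ : Fin n) (p : ℕ) : Prop :=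
  0 < p ∧ (k = ℓ → p = 1) ∧
  ∃ (u v : Fin p → Fin n) (α r : Fin p → ℝ),
    (∀ i : Fin p, (i : ℕ) = 0 → u i = k) ∧
    (∀ i : Fin p, (i : ℕ) + 1 = p → v i = ℓ) ∧
    (∀ i i' : Fin p, (i : ℕ) + 1 = i' → v i = u i') ∧
    (k < ℓ → ∀ i, u i < v i) ∧
    (∀ i, 0 < α i) ∧
    (∀ i, 0 < r i) ∧
    (∀ i j, u i ≤ j → j ≤ v i → x j = α i * r i ^ ((j : ℕ) - (u i : ℕ))) ∧
    (∀ j, (∀ i, ¬ (u i ≤ j ∧ j ≤ v i)) → x j = 0)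

/-! Existence: log-concavity without internal zeros amounts to the closed inequalities `x a * x d ≤
x b * x c` (`mem_lcFeasibleSet_iff`), so the feasible set is compact although it is a union over
open positivity conditions. A maximizer of largest norm is extreme. Structure: between consecutive
strictly log-concave indices the ratios of `x` are constant, so `x` is geometric there. If there
were `m` or more strict indices, a dimension count would give a nonzero `g`, affine off them, for
which `x * (1 + s * g)` keeps all moments; by `LCFeasibleOn.eventually_perturb` it is feasible for
all small `s` of either sign. Hence an extreme point has fewer than `m` strict indices, which cut
the support into at most `m` pieces. -/

/-- The zero extension of a vector to `ℕ`. -/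
noncomputable def natExtend {n : ℕ} (x : Fin n → ℝ) (j : ℕ) : ℝ :=
  if h : j < n then x ⟨j, h⟩ else 0

/-! ### Log-concave and geometric sequences on `ℕ`. -/

lemma natExtend_val {n : ℕ} (x : Fin n → ℝ) (j : Fin n) : natExtend x j = x j := by
  simp [natExtend]

lemma natExtend_of_lt {n : ℕ} (x : Fin n → ℝ) {j : ℕ} (h : j < n) :
    natExtend x j = x ⟨j, h⟩ := by
  simp [natExtend, h]

/-- The ratios `X (j + 1) / X j` decrease, so the last is at most the first. -/
lemma mul_succ_le_succ_mul_of_logConcave {X : ℕ → ℝ} {a c : ℕ} (hac : a ≤ c)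
    (hpos : ∀ j, a ≤ j → j ≤ c + 1 → 0 < X j)
    (hlc : ∀ j, a ≤ j → j + 2 ≤ c + 1 → X j * X (j + 2) ≤ X (j + 1) ^ 2) :
    X a * X (c + 1) ≤ X (a + 1) * X c := by
  induction c, hac using Nat.le_induction with
  | base => rw [mul_comm]
  | succ c hac ih =>
    have ih := ih (fun j h1 h2 => hpos j h1 (by omega)) (fun j h1 h2 => hlc j h1 (by omega))
    have h := hlc c hac le_rfl
    have ha := hpos a le_rfl (by omega)
    have hc := hpos c hac (by omega)
    have hc1 := hpos (c + 1) (by omega) (by omega)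
    refine le_of_mul_le_mul_right ?_ hc
    calc X a * X (c + 1 + 1) * X c = X a * (X c * X (c + 2)) := by ring
      _ ≤ X a * X (c + 1) ^ 2 := by gcongr
      _ = (X a * X (c + 1)) * X (c + 1) := by ring
      _ ≤ (X (a + 1) * X c) * X (c + 1) := by gcongr
      _ = X (a + 1) * X (c + 1) * X c := by ring

/-- The inequality forces `X (a + 1)` and `X c` to be positive once `X a` and `X (c + 1)` are, so
positivity moves inward from both ends. -/
lemma pos_of_pos_of_pos_of_mul_le {X : ℕ → ℝ} (hnn : ∀ j, 0 ≤ X j) {a c b : ℕ}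
    (h : ∀ i j, a ≤ i → i ≤ j → j + 1 ≤ c → X i * X (j + 1) ≤ X (i + 1) * X j)
    (hab : a ≤ b) (hbc : b ≤ c) (ha : 0 < X a) (hc : 0 < X c) : 0 < X b := by
  induction hN : b - a generalizing a c with
  | zero => rwa [show b = a by omega]
  | succ N ih =>
    rcases hbc.eq_or_lt with rfl | hlt
    · exact hc
    obtain ⟨c, rfl⟩ : ∃ c', c = c' + 1 := ⟨c - 1, by omega⟩
    have hp : 0 < X (a + 1) * X c := (mul_pos ha hc).trans_le (h a c le_rfl (by omega) le_rfl)
    have h1 : 0 < X (a + 1) := (hnn _).lt_of_ne' fun h0 => by simp [h0] at hp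
    have h2 : 0 < X c := (hnn _).lt_of_ne' fun h0 => by simp [h0] at hp
    exact ih (fun i j hi hij hj => h i j (by omega) hij (by omega)) (by omega) (by omega) h1 h2
      (by omega)

lemma geometric_of_mul_eq_sq {X : ℕ → ℝ} {u v : ℕ} (hpos : ∀ j, u ≤ j → j ≤ v → 0 < X j)
    (heq : ∀ j, u ≤ j → j + 2 ≤ v → X j * X (j + 2) = X (j + 1) ^ 2) (t : ℕ) (ht : u + t ≤ v) :
    X (u + t) = X u * (X (u + 1) / X u) ^ t := by
  have key : ∀ t, u + t + 1 ≤ v → X (u + t + 1) = X (u + t) * (X (u + 1) / X u) := by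
    intro t
    induction t with
    | zero =>
      intro h
      have := hpos u le_rfl (by omega)
      simp only [add_zero]
      field_simp
    | succ t ih =>
      intro h
      have ih := ih (by omega)
      have h1 := heq (u + t) (by omega) (by omega)
      have hp := hpos (u + t) (by omega) (by omega)
      have : X (u + t) * X (u + t + 2) = X (u + t) * (X (u + t + 1) * (X (u + 1) / X u)) := by
        rw [h1, ← mul_assoc, mul_right_comm, ← ih]; ring
      exact mul_left_cancel₀ hp.ne' this
  induction t with
  | zero => simp
  | succ t ih =>
    rw [← add_assoc, key t (by omega), ih (by omega)]; ring

/-! ### Compactness of the feasible region and existence of an extreme optimum. -/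

section LogConcave

variable {n m : ℕ} {w : Fin n → ℝ} {q : Fin (m + 1) → ℝ}

lemma LCFeasibleOn.nonneg {k ℓ : Fin n} {x : Fin n → ℝ} (hx : LCFeasibleOn w q k ℓ x)
    (j : Fin n) : 0 ≤ x j := by
  by_cases h : k ≤ j ∧ j ≤ ℓ
  · exact (hx.pos j h.1 h.2).le
  · exact (hx.zero j h).ge

lemma LCFeasibleOn.sum_univ {k ℓ : Fin n} {x : Fin n → ℝ} (hx : LCFeasibleOn w q k ℓ x)
    (i : Fin (m + 1)) : ∑ j, w j ^ (i : ℕ) * x j = q i := by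
  rw [← hx.moments i]
  refine (Finset.sum_subset (Finset.subset_univ _) fun j _ hj => ?_).symm
  rw [hx.zero j (by simpa using hj), mul_zero]

/-- This removes the support from the description and leaves only closed conditions. Inequalities
between distant indices are needed: the adjacent ones alone allow two or more consecutive zeros
inside the support. -/
lemma mem_lcFeasibleSet_iff (hq : q 0 = 1) (x : Fin n → ℝ) :
    x ∈ lcFeasibleSet w q ↔ (∀ j, 0 ≤ x j) ∧ (∀ i : Fin (m + 1), ∑ j, w j ^ (i : ℕ) * x j = q i) ∧
      ∀ a b c d : Fin n, (a : ℕ) + 1 = b → (c : ℕ) + 1 = d → a ≤ c → x a * x d ≤ x b * x c := by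
  constructor
  · rintro ⟨k, ℓ, -, hx⟩
    refine ⟨hx.nonneg, hx.sum_univ, fun a b c d hab hcd hac => ?_⟩
    by_cases ha : k ≤ a
    · by_cases hd : d ≤ ℓ
      · have hd' : (d : ℕ) ≤ ℓ := hd
        have ha' : (k : ℕ) ≤ a := ha
        have hac' : (a : ℕ) ≤ c := hac
        have := mul_succ_le_succ_mul_of_logConcave (X := natExtend x) hac'
          (fun j h1 h2 => by
            rw [natExtend_of_lt x (show j < n by omega)]
            exact hx.pos _ (Fin.mk_le_mk.2 (by omega)) (Fin.mk_le_mk.2 (by omega)))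
          (fun j h1 h2 => by
            rw [natExtend_of_lt x (show j < n by omega),
              natExtend_of_lt x (show j + 1 < n by omega),
              natExtend_of_lt x (show j + 2 < n by omega)]
            exact hx.logConcave _ _ _ rfl rfl (Fin.lt_def.2 (by simp; omega))
              (Fin.lt_def.2 (by simp; omega)))
        rwa [hab, hcd, natExtend_val, natExtend_val, natExtend_val, natExtend_val] at this
      · rw [hx.zero d (fun h => hd h.2), mul_zero]
        exact mul_nonneg (hx.nonneg _) (hx.nonneg _)
    · rw [hx.zero a (fun h => ha h.1), zero_mul]
      exact mul_nonneg (hx.nonneg _) (hx.nonneg _)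
  · rintro ⟨hnn, hmom, hlc⟩
    classical
    set s : Finset (Fin n) := Finset.univ.filter fun j => 0 < x j with hs
    have hne : s.Nonempty := by
      -- The total mass is `q 0 = 1`, so `x` cannot vanish identically.
      by_contra hemp
      have h0 : ∀ j, x j = 0 := fun j => by
        by_contra hj
        exact hemp ⟨j, by simpa [hs] using (hnn j).lt_of_ne' hj⟩
      have := hmom 0
      simp [h0, hq] at this
    have hmin : 0 < x (s.min' hne) := (Finset.mem_filter.1 (s.min'_mem hne)).2
    have hmax : 0 < x (s.max' hne) := (Finset.mem_filter.1 (s.max'_mem hne)).2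
    have hzero : ∀ j, ¬ (s.min' hne ≤ j ∧ j ≤ s.max' hne) → x j = 0 := by
      intro j hj
      by_contra h0
      have : j ∈ s := by simpa [hs] using (hnn j).lt_of_ne' h0
      exact hj ⟨s.min'_le _ this, s.le_max' _ this⟩
    refine ⟨s.min' hne, s.max' hne, s.min'_le _ (s.max'_mem hne), ?_, ?_, ?_, hzero⟩
    · intro i
      rw [← hmom i]
      refine Finset.sum_subset (Finset.subset_univ _) fun j _ hj => ?_
      rw [hzero j (by simpa using hj), mul_zero]
    · intro a b c hab hbc _ _
      rw [sq]
      exact hlc a b b c hab hbc (Fin.le_def.2 (by omega))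
    · intro j h1 h2
      rw [← natExtend_val x] at hmin hmax ⊢
      refine pos_of_pos_of_pos_of_mul_le (fun j => ?_) (fun i j hi hij hj => ?_)
        (Fin.le_def.1 h1) (Fin.le_def.1 h2) hmin hmax
      · unfold natExtend
        split_ifs
        exacts [hnn _, le_rfl]
      · have := (s.max' hne).2
        rw [natExtend_of_lt x (show i < n by omega), natExtend_of_lt x (show j < n by omega),
          natExtend_of_lt x (show i + 1 < n by omega), natExtend_of_lt x (show j + 1 < n by omega)]
        exact hlc _ _ _ _ rfl rfl (Fin.mk_le_mk.2 hij)

lemma isCompact_lcFeasibleSet (hq : q 0 = 1) : IsCompact (lcFeasibleSet w q) := by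
  refine (isCompact_Icc (a := (0 : Fin n → ℝ)) (b := 1)).of_isClosed_subset ?_ ?_
  · have : lcFeasibleSet w q = {x | (∀ j, 0 ≤ x j) ∧
        (∀ i : Fin (m + 1), ∑ j, w j ^ (i : ℕ) * x j = q i) ∧
        ∀ a b c d : Fin n, (a : ℕ) + 1 = b → (c : ℕ) + 1 = d → a ≤ c → x a * x d ≤ x b * x c} :=
      Set.ext (mem_lcFeasibleSet_iff hq)
    rw [this]
    simp only [Set.ofPred_and, Set.ofPred_forall]
    refine IsClosed.inter ?_ (IsClosed.inter ?_ ?_)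
    · exact isClosed_iInter fun j => isClosed_le (by fun_prop) (by fun_prop)
    · exact isClosed_iInter fun i => isClosed_eq (by fun_prop) (by fun_prop)
    · exact isClosed_iInter fun a => isClosed_iInter fun b => isClosed_iInter fun c =>
        isClosed_iInter fun d => isClosed_iInter fun _ => isClosed_iInter fun _ =>
        isClosed_iInter fun _ => isClosed_le (by fun_prop) (by fun_prop)
  · intro x hx
    obtain ⟨hnn, hmom, -⟩ := (mem_lcFeasibleSet_iff hq x).1 hx
    refine ⟨hnn, fun j => ?_⟩
    have h := hmom 0
    simp only [Fin.val_zero, pow_zero, one_mul, hq] at h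
    rw [Pi.one_apply, ← h]
    exact Finset.single_le_sum (fun j _ => hnn j) (Finset.mem_univ j)

/-- Among the optimal solutions, one of largest Euclidean norm is extreme. -/
lemma exists_isLCOptimal_isExtremePointOf (hq : q 0 = 1) (f : Fin n → ℝ)
    (hfeas : (lcFeasibleSet w q).Nonempty) :
    ∃ x : Fin n → ℝ, IsLCOptimal w q f x ∧ IsExtremePointOf (lcFeasibleSet w q) x := by
  have hf : Continuous (lcObjective f) := by unfold lcObjective; fun_prop
  have hc := isCompact_lcFeasibleSet (w := w) hq
  obtain ⟨z, hz, hzmax⟩ := hc.exists_isMaxOn hfeas hf.continuousOn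
  have hO : IsCompact (lcFeasibleSet w q ∩ {x | lcObjective f z ≤ lcObjective f x}) :=
    hc.inter_right (isClosed_le continuous_const hf)
  obtain ⟨x, ⟨hx, hxz⟩, hxmax⟩ := hO.exists_isMaxOn (f := fun x => ∑ j, x j ^ 2) ⟨z, hz, le_refl (lcObjective f z)⟩
    (by fun_prop)
  simp only [Set.mem_ofPred_eq] at hxz
  have hopt : IsLCOptimal w q f x := ⟨hx, fun y hy => le_trans (hzmax hy) hxz⟩
  refine ⟨x, hopt, hx, ?_⟩
  rintro ⟨d, hd, ε, hε, hp, hm⟩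
  -- The objective is linear, so both `x ± ε d` must be optimal as well.
  have hsum : lcObjective f (x + ε • d) + lcObjective f (x - ε • d) = 2 * lcObjective f x := by
    simp only [lcObjective, ← Finset.sum_add_distrib, Finset.mul_sum]
    refine Finset.sum_congr rfl fun j _ => ?_
    simp only [Pi.add_apply, Pi.sub_apply]
    ring
  have h1 := hopt.2 _ hp
  have h2 := hopt.2 _ hm
  have h3 := hxmax ⟨hp, show lcObjective f z ≤ lcObjective f (x + ε • d) by linarith⟩
  have h4 := hxmax ⟨hm, show lcObjective f z ≤ lcObjective f (x - ε • d) by linarith⟩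
  simp only [Set.mem_ofPred_eq] at h3 h4
  -- By the parallelogram law one of `x ± ε d` has larger norm than `x`.
  have h5 : ∑ j, (x + ε • d) j ^ 2 + ∑ j, (x - ε • d) j ^ 2
      = 2 * ∑ j, x j ^ 2 + 2 * ∑ j, (ε * d j) ^ 2 := by
    simp only [← Finset.sum_add_distrib, Finset.mul_sum]
    refine Finset.sum_congr rfl fun j _ => ?_
    simp only [Pi.add_apply, Pi.sub_apply, Pi.smul_apply, smul_eq_mul]
    ring
  obtain ⟨j, hj⟩ := Function.ne_iff.1 hd
  have h6 : 0 < ∑ j, (ε * d j) ^ 2 :=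
    Finset.sum_pos' (fun _ _ => sq_nonneg _)
      ⟨j, Finset.mem_univ _, by have : d j ≠ 0 := hj; positivity⟩
  linarith

/-! ### Perturbations that preserve feasibility. -/

open Classical in
/-- The interior indices of `[k, ℓ]` at which `x` is strictly log-concave. -/
noncomputable def strictIndices (k ℓ : Fin n) (x : Fin n → ℝ) : Finset (Fin n) :=
  (Finset.Ioo k ℓ).filter fun b =>
    ∀ a c : Fin n, (a : ℕ) + 1 = b → (b : ℕ) + 1 = c → x a * x c < x b ^ 2

lemma LCFeasibleOn.eq_sq_of_notMem_strictIndices {k ℓ : Fin n} {x : Fin n → ℝ}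
    (hx : LCFeasibleOn w q k ℓ x) {a b c : Fin n} (hab : (a : ℕ) + 1 = b) (hbc : (b : ℕ) + 1 = c)
    (hkb : k < b) (hbl : b < ℓ) (hb : b ∉ strictIndices k ℓ x) : x a * x c = x b ^ 2 := by
  refine (hx.logConcave a b c hab hbc hkb hbl).eq_of_not_lt fun hlt => hb ?_
  refine Finset.mem_filter.2 ⟨Finset.mem_Ioo.2 ⟨hkb, hbl⟩, fun a' c' h1 h2 => ?_⟩
  rwa [show a' = a from Fin.ext (by omega), show c' = c from Fin.ext (by omega)]

/-- If `x` is strictly log-concave at `m` or more indices, some nonzero `g` supported on `[k, ℓ]`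
is affine off these indices and annihilates the moments of `x * g`. -/
lemma exists_affine_off_strictIndices (w : Fin n → ℝ) {k ℓ : Fin n} (hkl : k < ℓ) (x : Fin n → ℝ)
    (hcard : m ≤ (strictIndices k ℓ x).card) :
    ∃ g : Fin n → ℝ, g ≠ 0 ∧ (∀ j, ¬ (k ≤ j ∧ j ≤ ℓ) → g j = 0) ∧
      (∀ i : Fin (m + 1), ∑ j, w j ^ (i : ℕ) * (x j * g j) = 0) ∧
      ∀ a b c : Fin n, (a : ℕ) + 1 = b → (b : ℕ) + 1 = c → k < b → b < ℓ →
        b ∉ strictIndices k ℓ x → g a + g c = 2 * g b := by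
  classical
  set B := strictIndices k ℓ x
  have hB : B ⊆ Finset.Ioo k ℓ := Finset.filter_subset _ _
  let O : Finset (Fin n) := (Finset.Icc k ℓ)ᶜ
  let D : Finset (Fin n) := Finset.Ioo k ℓ \ B
  have hD : ∀ b : D, k < b.1 ∧ b.1 < ℓ := fun b =>
    Finset.mem_Ioo.1 (Finset.mem_sdiff.1 b.2).1
  let L1 : (Fin n → ℝ) →ₗ[ℝ] (Fin (m + 1) → ℝ) :=
    LinearMap.pi fun i => ∑ j, (w j ^ (i : ℕ) * x j) • LinearMap.proj j
  let L2 : (Fin n → ℝ) →ₗ[ℝ] (O → ℝ) := LinearMap.pi fun j => LinearMap.proj j.1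
  let P (j : Fin n) : (Fin n → ℝ) →ₗ[ℝ] ℝ := LinearMap.proj j
  let L3 : (Fin n → ℝ) →ₗ[ℝ] (D → ℝ) := LinearMap.pi fun b =>
    P ⟨(b.1 : ℕ) - 1, by omega⟩ + P ⟨(b.1 : ℕ) + 1, by have := (hD b).2; omega⟩ - (2 : ℝ) • P b.1
  -- With `|B|` strict indices the conditions number `(m + 1) + (n - (ℓ - k + 1)) + (ℓ - k - 1 -
  -- |B|) = n + m - 1 - |B|`, which is less than `n`.
  have hdim : Module.finrank ℝ ((Fin (m + 1) → ℝ) × (O → ℝ) × (D → ℝ))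
      < Module.finrank ℝ (Fin n → ℝ) := by
    simp only [Module.finrank_prod, Module.finrank_fintype_fun_eq_card, Fintype.card_fin,
      Fintype.card_coe]
    have h1 : O.card = n - (ℓ + 1 - k) := by
      rw [Finset.card_compl, Fintype.card_fin, Fin.card_Icc]
    have h2 : D.card = (ℓ - k - 1) - B.card := by
      rw [Finset.card_sdiff_of_subset hB, Fin.card_Ioo]
    have h3 : B.card ≤ ℓ - k - 1 := by rw [← Fin.card_Ioo]; exact Finset.card_le_card hB
    have := ℓ.2
    omega
  obtain ⟨g, hg, hg0⟩ := (Submodule.ne_bot_iff _).1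
    (LinearMap.ker_ne_bot_of_finrank_lt (f := L1.prod (L2.prod L3)) hdim)
  rw [LinearMap.mem_ker] at hg
  have hg1 : L1 g = 0 := congrArg Prod.fst hg
  have hg2 : L2 g = 0 := congrArg (fun z => z.2.1) hg
  have hg3 : L3 g = 0 := congrArg (fun z => z.2.2) hg
  refine ⟨g, hg0, fun j hj => ?_, fun i => ?_, fun a b c hab hbc hkb hbl hb => ?_⟩
  · exact congrFun hg2 ⟨j, by simpa [O] using hj⟩
  · have := congrFun hg1 i
    simpa [L1, mul_assoc] using this
  · have := congrFun hg3 ⟨b, Finset.mem_sdiff.2 ⟨Finset.mem_Ioo.2 ⟨hkb, hbl⟩, hb⟩⟩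
    simp only [L3, P, LinearMap.pi_apply, LinearMap.sub_apply, LinearMap.add_apply,
      LinearMap.smul_apply, LinearMap.proj_apply, Pi.zero_apply, smul_eq_mul] at this
    rw [show (⟨(b : ℕ) - 1, by omega⟩ : Fin n) = a from Fin.ext (by simp; omega),
      show (⟨(b : ℕ) + 1, by omega⟩ : Fin n) = c from Fin.ext hbc] at this
    linarith

open Filter Topology in
-- Strict inequalities and positivity survive small changes by continuity. Where equality holds, `g
-- b` is the mean of its neighbours, and log-concavity of `1 + s * g` there is the AM-GM inequality.
lemma LCFeasibleOn.eventually_perturb {k ℓ : Fin n} {x g : Fin n → ℝ}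
    (hx : LCFeasibleOn w q k ℓ x)
    (hmom : ∀ i : Fin (m + 1), ∑ j, w j ^ (i : ℕ) * (x j * g j) = 0)
    (haff : ∀ a b c : Fin n, (a : ℕ) + 1 = b → (b : ℕ) + 1 = c → k < b → b < ℓ →
        b ∉ strictIndices k ℓ x → g a + g c = 2 * g b) :
    ∀ᶠ s in 𝓝 (0 : ℝ), LCFeasibleOn w q k ℓ fun j => x j * (1 + s * g j) := by
  have hzero : ∀ (s : ℝ) (j), ¬ (k ≤ j ∧ j ≤ ℓ) → x j * (1 + s * g j) = 0 := fun s j hj => by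
    rw [hx.zero j hj, zero_mul]
  have hpos : ∀ᶠ s in 𝓝 (0 : ℝ), ∀ j, k ≤ j → j ≤ ℓ → 0 < x j * (1 + s * g j) := by
    simp only [eventually_all]
    intro j h1 h2
    have hc : ContinuousAt (fun s : ℝ => x j * (1 + s * g j)) 0 := by fun_prop
    exact hc.eventually (lt_mem_nhds (by simpa using hx.pos j h1 h2))
  have hlc : ∀ᶠ s in 𝓝 (0 : ℝ), ∀ a b c : Fin n, (a : ℕ) + 1 = b → (b : ℕ) + 1 = c →
      k < b → b < ℓ →
      (x a * (1 + s * g a)) * (x c * (1 + s * g c)) ≤ (x b * (1 + s * g b)) ^ 2 := by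
    simp only [eventually_all]
    intro a b c hab hbc hkb hbl
    by_cases hb : b ∈ strictIndices k ℓ x
    · have hlt := (Finset.mem_filter.1 hb).2 a c hab hbc
      have h1 : ContinuousAt
        (fun s : ℝ => (x a * (1 + s * g a)) * (x c * (1 + s * g c))) 0 := by fun_prop
      have h2 : ContinuousAt (fun s : ℝ => (x b * (1 + s * g b)) ^ 2) 0 := by fun_prop
      exact (h1.eventually_lt h2 (by simpa using hlt)).mono fun s hs => hs.le
    · refine Eventually.of_forall fun s => ?_
      have heq := hx.eq_sq_of_notMem_strictIndices hab hbc hkb hbl hb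
      have hg := haff a b c hab hbc hkb hbl hb
      have hgb : g b = (g a + g c) / 2 := by linarith
      calc (x a * (1 + s * g a)) * (x c * (1 + s * g c))
          = x b ^ 2 * ((1 + s * g a) * (1 + s * g c)) := by rw [← heq]; ring
        _ ≤ x b ^ 2 * (1 + s * g b) ^ 2 := by
          gcongr
          rw [hgb]
          nlinarith [sq_nonneg (s * g a - s * g c)]
        _ = (x b * (1 + s * g b)) ^ 2 := by ring
  filter_upwards [hpos, hlc] with s h1 h2
  refine ⟨fun i => ?_, h2, h1, hzero s⟩
  have : ∑ j ∈ Finset.Icc k ℓ, w j ^ (i : ℕ) * (x j * (1 + s * g j))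
      = ∑ j, w j ^ (i : ℕ) * (x j * (1 + s * g j)) :=
    Finset.sum_subset (Finset.subset_univ _) fun j _ hj => by
      rw [hzero s j (by simpa using hj), mul_zero]
  rw [this, ← hx.sum_univ i, ← add_zero (∑ j, w j ^ (i : ℕ) * x j), ← mul_zero s, ← hmom i,
    Finset.mul_sum, ← Finset.sum_add_distrib]
  exact Finset.sum_congr rfl fun j _ => by ring

lemma card_strictIndices_lt_of_isExtremePointOf {k ℓ : Fin n} {x : Fin n → ℝ} (hkl : k < ℓ)
    (hx : LCFeasibleOn w q k ℓ x) (hext : IsExtremePointOf (lcFeasibleSet w q) x) :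
    (strictIndices k ℓ x).card < m := by
  by_contra! hcard
  obtain ⟨g, hg0, hgout, hmom, haff⟩ := exists_affine_off_strictIndices w hkl x hcard
  obtain ⟨ε, hε, hball⟩ := Metric.eventually_nhds_iff.1 (hx.eventually_perturb hmom haff)
  have h1 := @hball (ε / 2) (by rw [Real.dist_eq, sub_zero, abs_of_pos (by positivity)]; linarith)
  have h2 := @hball (-(ε / 2)) (by
    rw [Real.dist_eq, sub_zero, abs_neg, abs_of_pos (by positivity)]; linarith)
  refine hext.2 ⟨fun j => x j * g j, ?_, ε / 2, by positivity, ⟨k, ℓ, hkl.le, ?_⟩,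
    ⟨k, ℓ, hkl.le, ?_⟩⟩
  -- The direction `x * g` is nonzero because `g` lives where `x` is positive.
  · obtain ⟨j, hj⟩ := Function.ne_iff.1 hg0
    refine Function.ne_iff.2 ⟨j, mul_ne_zero (fun h0 => hj (hgout j fun h => ?_)) hj⟩
    exact (hx.pos j h.1 h.2).ne' h0
  · convert h1 using 1
    ext j
    simp only [Pi.add_apply, Pi.smul_apply, smul_eq_mul]
    ring
  · convert h2 using 1
    ext j
    simp only [Pi.sub_apply, Pi.smul_apply, smul_eq_mul]
    ring

/-! ### Decomposition into geometric pieces. -/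

/-- Any set of interior indices containing the strict ones cuts `[k, ℓ]` into geometric pieces. -/
lemma LCFeasibleOn.isPiecewiseGeometric {k ℓ : Fin n} {x : Fin n → ℝ} (hkl : k < ℓ)
    (hx : LCFeasibleOn w q k ℓ x) {T : Finset (Fin n)} (hBT : strictIndices k ℓ x ⊆ T)
    (hT : T ⊆ Finset.Ioo k ℓ) : IsPiecewiseGeometric x k ℓ (T.card + 1) := by
  classical
  set T' : Finset (Fin n) := insert k (insert ℓ T) with hT'
  have hmem : ∀ j ∈ T', k ≤ j ∧ j ≤ ℓ := by
    intro j hj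
    rcases Finset.mem_insert.1 hj with rfl | hj
    · exact ⟨le_rfl, hkl.le⟩
    rcases Finset.mem_insert.1 hj with rfl | hj
    · exact ⟨hkl.le, le_rfl⟩
    have := Finset.mem_Ioo.1 (hT hj)
    exact ⟨this.1.le, this.2.le⟩
  have hk : k ∈ T' := Finset.mem_insert_self _ _
  have hl : ℓ ∈ T' := Finset.mem_insert_of_mem (Finset.mem_insert_self _ _)
  have hcard : T'.card = T.card + 1 + 1 := by
    have h1 : ℓ ∉ T := fun h => lt_irrefl _ (Finset.mem_Ioo.1 (hT h)).2
    have h2 : k ∉ insert ℓ T := fun h => by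
      rcases Finset.mem_insert.1 h with h | h
      · exact hkl.ne h
      · exact lt_irrefl _ (Finset.mem_Ioo.1 (hT h)).1
    rw [hT', Finset.card_insert_of_notMem h2, Finset.card_insert_of_notMem h1]
  -- The increasing enumeration of the breakpoints, endpoints included; piece `i` runs from its
  -- `i`-th to its `(i + 1)`-th value.
  let e := T'.orderEmbOfFin hcard
  have he : ∀ i, e i ∈ T' := T'.orderEmbOfFin_mem hcard
  have hsurj : ∀ j ∈ T', ∃ i, e i = j := fun j hj => by
    have : j ∈ Set.range e := by rw [Finset.range_orderEmbOfFin]; exact hj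
    exact this
  have he0 : e 0 = k := by
    obtain ⟨i, hi⟩ := hsurj k hk
    exact le_antisymm (hi ▸ e.monotone (Fin.zero_le i)) (hmem _ (he 0)).1
  have helast : e (Fin.last _) = ℓ := by
    obtain ⟨i, hi⟩ := hsurj ℓ hl
    exact le_antisymm (hmem _ (he _)).2 (hi ▸ e.monotone (Fin.le_last i))
  have hgap : ∀ (i : Fin (T.card + 1)) (b : Fin n), e i.castSucc < b → b < e i.succ → b ∉ T := by
    intro i b h1 h2 hb
    obtain ⟨i', rfl⟩ := hsurj b (Finset.mem_insert_of_mem (Finset.mem_insert_of_mem hb))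
    have h1 := Fin.lt_def.1 (e.lt_iff_lt.1 h1)
    have h2 := Fin.lt_def.1 (e.lt_iff_lt.1 h2)
    simp only [Fin.val_castSucc, Fin.val_succ] at h1 h2
    omega
  have hlt : ∀ i : Fin (T.card + 1), e i.castSucc < e i.succ := fun i =>
    e.strictMono Fin.castSucc_lt_succ
  have hXpos : ∀ j : ℕ, (k : ℕ) ≤ j → j ≤ ℓ → 0 < natExtend x j := fun j h1 h2 => by
    rw [natExtend_of_lt x (show j < n by omega)]
    exact hx.pos _ (Fin.le_def.2 h1) (Fin.le_def.2 h2)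
  have hb1 : ∀ i, (k : ℕ) ≤ e i := fun i => (hmem _ (he i)).1
  have hb2 : ∀ i, (e i : ℕ) ≤ ℓ := fun i => (hmem _ (he i)).2
  refine ⟨Nat.succ_pos _, fun h => absurd h hkl.ne, fun i => e i.castSucc, fun i => e i.succ,
    fun i => natExtend x (e i.castSucc),
    fun i => natExtend x ((e i.castSucc : ℕ) + 1) / natExtend x (e i.castSucc),
    ?_, ?_, ?_, fun _ => hlt, ?_, ?_, ?_, ?_⟩
  · intro i hi
    simp only [show i.castSucc = 0 from Fin.ext hi, he0]
  · intro i hi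
    simp only [show i.succ = Fin.last _ from Fin.ext (by simpa using hi), helast]
  · intro i i' h
    exact congrArg e (Fin.ext (by simpa using h))
  · exact fun i => hXpos _ (hb1 _) (hb2 _)
  · intro i
    have h1 := Fin.lt_def.1 (hlt i)
    have h2 := hb2 i.succ
    have h3 := hb1 i.castSucc
    exact div_pos (hXpos _ (by omega) (by omega)) (hXpos _ h3 (by omega))
  · intro i j (h1 : e i.castSucc ≤ j) (h2 : j ≤ e i.succ)
    have h3 := hb2 i.succ
    have h4 := hb1 i.castSucc
    have h1' := Fin.le_def.1 h1
    have h2' := Fin.le_def.1 h2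
    have := geometric_of_mul_eq_sq (X := natExtend x) (u := e i.castSucc) (v := e i.succ)
      (fun j _ _ => hXpos j (by omega) (by omega))
      (fun j hj1 hj2 => by
        rw [natExtend_of_lt x (show j < n by omega), natExtend_of_lt x (show j + 1 < n by omega),
          natExtend_of_lt x (show j + 2 < n by omega)]
        refine hx.eq_sq_of_notMem_strictIndices rfl rfl (Fin.lt_def.2 (by simp; omega))
          (Fin.lt_def.2 (by simp; omega)) fun hb => hgap i _ ?_ ?_ (hBT hb)
        · exact Fin.lt_def.2 (by simp; omega)
        · exact Fin.lt_def.2 (by simp; omega))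
      ((j : ℕ) - (e i.castSucc : ℕ)) (by omega)
    rwa [Nat.add_sub_cancel' h1', natExtend_val x j] at this
  · intro j hj
    refine hx.zero j fun ⟨h1, h2⟩ => ?_
    -- The first breakpoint at or beyond `j` is the right end of a piece containing `j`, unless `j =
    -- k`.
    have hex : ∃ i : Fin (T.card + 1 + 1), j ≤ e i := ⟨Fin.last _, helast ▸ h2⟩
    rcases Fin.eq_zero_or_eq_succ (Fin.find _ hex) with h0 | ⟨i, hi⟩
    · have hs := Fin.find_spec hex
      rw [h0, he0] at hs
      exact hj 0 ⟨he0.le.trans h1, hs.trans (he0.ge.trans (hlt 0).le)⟩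
    · have hs := Fin.find_spec hex
      rw [hi] at hs
      exact hj i ⟨(not_le.1 (Fin.find_min hex (hi ▸ Fin.castSucc_lt_succ))).le, hs⟩

lemma LCFeasibleOn.isPiecewiseGeometric_self {k : Fin n} {x : Fin n → ℝ}
    (hx : LCFeasibleOn w q k k x) : IsPiecewiseGeometric x k k 1 := by
  refine ⟨one_pos, fun _ => rfl, fun _ => k, fun _ => k, fun _ => x k, fun _ => 1, fun _ _ => rfl,
    fun _ _ => rfl, fun _ _ _ => rfl, fun h => absurd h (lt_irrefl _),
    fun _ => hx.pos k le_rfl le_rfl, fun _ => one_pos, fun _ j h1 h2 => ?_,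
    fun j hj => hx.zero j (hj 0)⟩
  rw [le_antisymm h2 h1]
  simp

lemma exists_isPiecewiseGeometric_of_isExtremePointOf (hm : 1 ≤ m) {x : Fin n → ℝ}
    (hext : IsExtremePointOf (lcFeasibleSet w q) x) :
    ∃ k ℓ : Fin n, k ≤ ℓ ∧ Function.support x = Set.Icc k ℓ ∧
      ∃ p : ℕ, p ≤ m ∧ ((k : ℕ) + m ≤ (ℓ : ℕ) → p = m) ∧ IsPiecewiseGeometric x k ℓ p := by
  obtain ⟨k, ℓ, hkl, hx⟩ := hext.1
  refine ⟨k, ℓ, hkl, ?_, ?_⟩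
  · ext j
    refine ⟨fun hj => by_contra fun h => hj (hx.zero j h), fun h => (hx.pos j h.1 h.2).ne'⟩
  rcases hkl.eq_or_lt with rfl | hlt
  · exact ⟨1, hm, fun h => by omega, hx.isPiecewiseGeometric_self⟩
  have hcard := card_strictIndices_lt_of_isExtremePointOf hlt hx hext
  have hsub : strictIndices k ℓ x ⊆ Finset.Ioo k ℓ := Finset.filter_subset _ _
  by_cases h : (k : ℕ) + m ≤ ℓ
  -- There are at least `m - 1` interior indices, so artificial breakpoints can raise the number of
  -- pieces to exactly `m`.
  · obtain ⟨T, h1, h2, h3⟩ := Finset.exists_subsuperset_card_eq hsub (n := m - 1) (by omega)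
      (by rw [Fin.card_Ioo]; omega)
    have := hx.isPiecewiseGeometric hlt h1 h2
    rw [h3, Nat.sub_add_cancel hm] at this
    exact ⟨m, le_rfl, fun _ => rfl, this⟩
  -- On a short support every interior index serves as a breakpoint, giving `ℓ - k < m` pieces.
  · refine ⟨_, ?_, fun h' => absurd h' h, hx.isPiecewiseGeometric hlt hsub subset_rfl⟩
    rw [Fin.card_Ioo]
    have := Fin.lt_def.1 hlt
    omega

end LogConcave

theorem mainTheorem2 (n m : ℕ) (hm : 1 ≤ m) (w f : Fin n → ℝ) (q : Fin (m + 1) → ℝ)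
    (hq : q 0 = 1) (hfeas : (lcFeasibleSet w q).Nonempty) :
    (∃ x : Fin n → ℝ, IsLCOptimal w q f x ∧ IsExtremePointOf (lcFeasibleSet w q) x) ∧
    (∀ x : Fin n → ℝ, IsLCOptimal w q f x → IsExtremePointOf (lcFeasibleSet w q) x →
      ∃ k ℓ : Fin n, k ≤ ℓ ∧ Function.support x = Set.Icc k ℓ ∧
        ∃ p : ℕ, p ≤ m ∧ ((k : ℕ) + m ≤ (ℓ : ℕ) → p = m) ∧ IsPiecewiseGeometric x k ℓ p) :=
  ⟨exists_isLCOptimal_isExtremePointOf hq f hfeas,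
    fun _ _ hext => exists_isPiecewiseGeometric_of_isExtremePointOf hm hext⟩
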